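/- All graphs are finite and simple. A graph $G$ is a cograph if it can be obtained from one-vertex graphs by repeatedly taking the disjoint union of two vertex-disjoint graphs, or their complete join (the disjoint union together with all edges between the two vertex sets). Equivalently phrased, $G$ has a cotree: a rooted binary tree whose leaves are the vertices of $G$, whose internal nodes each have two children and are marked as union or join nodes, and whose root represents $G$ under these operations. For a graph $G$ and an integer $k$, let $\mathrm{TJ}_k(G)$ be the graph whose vertices are the independent sets of $G$ of size exactly $k$, where two distinct independent sets $I$ and $J$ are adjacent if there are vertices $u\in I$ and $v\in J$ with $I\setminus\{u\}=J\setminus\{v\}$. Let $G$ be a cograph on $n$ vertices and let $k$ be an integer. Then every connected component of $\mathrm{TJ}_k(G)$ has (finite) diameter at most $2n-k$. -/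

import Mathlib

/-- A binary tree whose internal nodes are marked as union nodes or join nodes (with a left and a
right child) and whose leaves carry a single vertex of `V`. -/
inductive Cotree (V : Type*) where
  | leaf (v : V) : Cotree V
  | union (l r : Cotree V) : Cotree V
  | join (l r : Cotree V) : Cotree V

namespace Cotree

variable {V : Type*}

/-- The vertex set of the graph of the root of the tree. -/
def verts : Cotree V → Set V
  | leaf v => {v}
  | union l r => l.verts ∪ r.verts
  | join l r => l.verts ∪ r.verts

/-- Different leaves carry different vertices: at every internal node, the graphs of the two
children are vertex disjoint. -/
def Valid : Cotree V → Prop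
  | leaf _ => True
  | union l r => l.Valid ∧ r.Valid ∧ Disjoint l.verts r.verts
  | join l r => l.Valid ∧ r.Valid ∧ Disjoint l.verts r.verts

/-- Adjacency in the graph of the root of the tree: a leaf has no edges, a union node has the edges
of its two children, and a join node has in addition all edges between the vertices of its left
child and the vertices of its right child. -/
def Adj : Cotree V → V → V → Prop
  | leaf _, _, _ => False
  | union l r, x, y => l.Adj x y ∨ r.Adj x y
  | join l r, x, y => l.Adj x y ∨ r.Adj x y ∨
      (x ∈ l.verts ∧ y ∈ r.verts) ∨ (x ∈ r.verts ∧ y ∈ l.verts)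

/-- `T` is a cotree for `G`: the graph of the root of `T` is `G`. -/
def IsCotreeFor (T : Cotree V) (G : SimpleGraph V) : Prop :=
  T.Valid ∧ T.verts = Set.univ ∧ ∀ x y, G.Adj x y ↔ T.Adj x y

end Cotree

/-- A cograph is a graph that has a cotree. -/
def IsCograph {V : Type*} (G : SimpleGraph V) : Prop :=
  ∃ T : Cotree V, T.IsCotreeFor G

/-- The token jumping graph `TJ_k(G)`: its vertices are the independent sets of `G` of size exactly
`k`, and two distinct ones `I`, `J` are adjacent if `I \ {u} = J \ {v}` for some `u ∈ I`,
`v ∈ J`. -/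
def tokenJumpingGraph {V : Type*} [DecidableEq V] (G : SimpleGraph V) (k : ℤ) :
    SimpleGraph {I : Finset V // G.IsIndepSet (I : Set V) ∧ (I.card : ℤ) = k} where
  Adj I J := I ≠ J ∧ ∃ u ∈ I.1, ∃ v ∈ J.1, I.1 \ {u} = J.1 \ {v}
  symm := ⟨fun _ _ ⟨hne, u, hu, v, hv, h⟩ => ⟨hne.symm, v, hv, u, hu, h.symm⟩⟩
  loopless := ⟨fun _ h => h.1 rfl⟩

/-!
In a cotree, choose for every node a maximum independent set of its subtree, compatibly: the choices
at the two children of a union node are united, and at a join node the larger one is kept. Replacing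
the part of an independent set `I` inside a subtree by the chosen set never decreases the size of
`I`, and it takes token additions and removals that keep at least `k` tokens as long as `k` tokens
lie outside the subtree. Call a subtree saturated if `I` restricts to its chosen set. Each such
replacement enlarges the union of the saturated subtrees, and does so by all the vertices it adds to
`I`; hence `I` reaches, in at most twice the growth of this region many steps, a stable set, for
which no further replacement is possible. Independent sets reachable from a stable set stay inside
its saturated region, and this makes the stable set of a connected component unique.

Through the stable set, two independent sets of size `k` that are connected by token jumps are at
distance at most `4 * (n - k)` under token additions and removals keeping at least `k - 1` tokens.
Since two such moves make up one jump, the distance under token jumps is at most `2 * (n - k)`.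
-/

namespace Cotree

section

variable {V : Type*} {S S' T : Cotree V} {x y : V} {I I' : Finset V}

theorem Adj.symm (h : T.Adj x y) : T.Adj y x := by
  induction T <;> grind [Adj]

theorem not_adj_self (hT : T.Valid) : ¬ T.Adj x x := by
  induction T <;> grind [Adj, Valid]

/-- `S.IsSubtree T`: the tree `S` consists of some node of `T` and all its descendants. -/
inductive IsSubtree : Cotree V → Cotree V → Prop
  | refl (T : Cotree V) : IsSubtree T T
  | union_left {S l r : Cotree V} : S.IsSubtree l → S.IsSubtree (union l r)
  | union_right {S l r : Cotree V} : S.IsSubtree r → S.IsSubtree (union l r)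
  | join_left {S l r : Cotree V} : S.IsSubtree l → S.IsSubtree (join l r)
  | join_right {S l r : Cotree V} : S.IsSubtree r → S.IsSubtree (join l r)

theorem IsSubtree.trans (h : S.IsSubtree S') (h' : S'.IsSubtree T) : S.IsSubtree T := by
  induction h' <;> grind [IsSubtree]

theorem IsSubtree.valid (hT : T.Valid) (h : S.IsSubtree T) : S.Valid := by
  induction h <;> grind [Valid]

theorem IsSubtree.adj_mono (h : S.IsSubtree T) (hxy : S.Adj x y) : T.Adj x y := by
  induction h <;> grind [Adj]

/-- No two elements of `I` are adjacent in the graph of the root of the tree. -/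
def Indep (T : Cotree V) (I : Finset V) : Prop := ∀ x ∈ I, ∀ y ∈ I, ¬ T.Adj x y

theorem IsCotreeFor.indep_iff {G : SimpleGraph V} (h : T.IsCotreeFor G) :
    T.Indep I ↔ G.IsIndepSet (I : Set V) := by
  constructor
  · exact fun hI x hx y hy _ hxy => hI x hx y hy ((h.2.2 x y).1 hxy)
  · intro hI x hx y hy hxy
    have hxy := (h.2.2 x y).2 hxy
    exact hI hx hy hxy.ne hxy

theorem Indep.mono (h : T.Indep I') (hI : I ⊆ I') : T.Indep I :=
  fun x hx y hy => h x (hI hx) y (hI hy)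

theorem Indep.of_isSubtree (h : T.Indep I) (hS : S.IsSubtree T) : S.Indep I :=
  fun x hx y hy hxy => h x hx y hy (hS.adj_mono hxy)

end

variable {V : Type*} [DecidableEq V] {S S' T l r : Cotree V} {x y z : V} {D I L M N : Finset V}
  {k : ℤ}

/-- The vertex set of the graph of the root of the tree, as a finset; see `Cotree.coe_support`. -/
def support : Cotree V → Finset V
  | leaf v => {v}
  | union l r => l.support ∪ r.support
  | join l r => l.support ∪ r.support

theorem coe_support (T : Cotree V) : (T.support : Set V) = T.verts := by
  induction T <;> simp_all [support, verts]

theorem mem_verts : x ∈ T.verts ↔ x ∈ T.support := by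
  rw [← coe_support, Finset.mem_coe]

theorem disjoint_support_iff : Disjoint l.support r.support ↔ Disjoint l.verts r.verts := by
  rw [← Finset.disjoint_coe, coe_support, coe_support]

theorem Adj.mem_support_left (h : T.Adj x y) : x ∈ T.support := by
  induction T <;> grind [Adj, support, mem_verts]

theorem Adj.mem_support_right (h : T.Adj x y) : y ∈ T.support :=
  h.symm.mem_support_left

theorem isSubtree_leaf (hx : x ∈ T.support) : (leaf x).IsSubtree T := by
  induction T <;> grind [support, IsSubtree]

theorem IsSubtree.support_subset (h : S.IsSubtree T) : S.support ⊆ T.support := by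
  induction h <;> grind [support]

theorem IsSubtree.adj_of_mem (hT : T.Valid) (h : S.IsSubtree T) (hx : x ∈ S.support)
    (hy : y ∈ S.support) (hxy : T.Adj x y) : S.Adj x y := by
  induction h with
  | refl => exact hxy
  | union_left h ih | union_right h ih | join_left h ih | join_right h ih =>
    have hd := Finset.disjoint_left.1 (disjoint_support_iff.2 hT.2.2)
    grind [Adj, Valid, mem_verts, Adj.mem_support_left, h.support_subset hx, h.support_subset hy]

/-- The witness `S` is the join node at which `x` and `y` become adjacent, and `A` is the child of
`S` above `x`. -/
theorem Adj.exists_isSubtree (hT : T.Valid) (h : T.Adj x y) : ∃ A S : Cotree V,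
    A.IsSubtree S ∧ S.IsSubtree T ∧ x ∈ A.support ∧ y ∈ S.support \ A.support ∧
      ∀ p ∈ A.support, ∀ q ∈ S.support \ A.support, T.Adj p q := by
  induction T with
  | leaf => exact h.elim
  | union l r ihl ihr => grind [Adj, IsSubtree, Valid]
  | join l r ihl ihr =>
    have hd := Finset.disjoint_left.1 (disjoint_support_iff.2 hT.2.2)
    rcases h with h | h | ⟨hx, hy⟩ | ⟨hx, hy⟩
    · grind [Adj, IsSubtree, Valid]
    · grind [Adj, IsSubtree, Valid]
    · exact ⟨l, _, .join_left (.refl l), .refl _, by grind [support, mem_verts, Adj]⟩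
    · exact ⟨r, _, .join_right (.refl r), .refl _, by grind [support, mem_verts, Adj]⟩

theorem IsSubtree.adj_of_adj_of_notMem (hT : T.Valid) (h : S.IsSubtree T) (hx : x ∈ S.support)
    (hy : y ∈ S.support) (hz : z ∉ S.support) (hxz : T.Adj x z) : T.Adj y z := by
  induction h with
  | refl => exact absurd hxz.mem_support_right hz
  | union_left h ih | union_right h ih | join_left h ih | join_right h ih =>
    have hd := Finset.disjoint_left.1 (disjoint_support_iff.2 hT.2.2)
    grind [Adj, Valid, mem_verts, Adj.mem_support_left, h.support_subset hx, h.support_subset hy]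

theorem IsSubtree.laminar (hT : T.Valid) (h : S.IsSubtree T) (h' : S'.IsSubtree T) :
    S.IsSubtree S' ∨ S'.IsSubtree S ∨ Disjoint S.support S'.support := by
  induction h with
  | refl => exact .inr (.inl h')
  | union_left h ih | union_right h ih | join_left h ih | join_right h ih =>
    have hd := disjoint_support_iff.2 hT.2.2
    cases h' with
    | refl => grind [IsSubtree]
    | _ h' =>
      first
      | exact ih hT.1 h'
      | exact ih hT.2.1 h'
      | exact .inr (.inr (hd.mono h.support_subset h'.support_subset))
      | exact .inr (.inr (hd.symm.mono h.support_subset h'.support_subset))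

theorem Indep.disjoint_of_join (h : (join l r).Indep I) :
    Disjoint I l.support ∨ Disjoint I r.support := by
  simp only [Finset.disjoint_left]
  grind [Indep, Adj, mem_verts]

/-- A maximum independent set, chosen so that its restriction to each subtree is empty or the
chosen maximum independent set of that subtree. -/
def maxIndep : Cotree V → Finset V
  | leaf v => {v}
  | union l r => l.maxIndep ∪ r.maxIndep
  | join l r => if r.maxIndep.card ≤ l.maxIndep.card then l.maxIndep else r.maxIndep

theorem maxIndep_subset (T : Cotree V) : T.maxIndep ⊆ T.support := by
  induction T <;> grind [maxIndep, support]

theorem maxIndep_nonempty (T : Cotree V) : T.maxIndep.Nonempty := by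
  induction T with
  | leaf v => exact Finset.singleton_nonempty v
  | union l r ihl _ => exact ihl.inl
  | join l r ihl ihr => unfold maxIndep; split_ifs <;> assumption

theorem indep_maxIndep (hT : T.Valid) : T.Indep T.maxIndep := by
  induction T with
  | leaf v => exact fun x _ y _ h => h
  | union l r ihl ihr | join l r ihl ihr =>
    have hd := Finset.disjoint_left.1 (disjoint_support_iff.2 hT.2.2)
    have hl := l.maxIndep_subset
    have hr := r.maxIndep_subset
    grind [Valid, Indep, Adj, maxIndep, mem_verts, Adj.mem_support_left, Adj.mem_support_right]

theorem Indep.card_inter_support_le (hT : T.Valid) (hI : T.Indep I) :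
    (I ∩ T.support).card ≤ T.maxIndep.card := by
  induction T with
  | leaf v => exact Finset.card_le_card Finset.inter_subset_right
  | union l r ihl ihr =>
    have hd := disjoint_support_iff.2 hT.2.2
    rw [support, maxIndep, Finset.inter_union_distrib_left,
      Finset.card_union_of_disjoint (hd.mono l.maxIndep_subset r.maxIndep_subset)]
    exact (Finset.card_union_le _ _).trans (add_le_add
      (ihl hT.1 (hI.of_isSubtree (.union_left (.refl _))))
      (ihr hT.2.1 (hI.of_isSubtree (.union_right (.refl _)))))
  | join l r ihl ihr =>
    have hl := ihl hT.1 (hI.of_isSubtree (.join_left (.refl _)))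
    have hr := ihr hT.2.1 (hI.of_isSubtree (.join_right (.refl _)))
    rw [support, maxIndep, Finset.inter_union_distrib_left]
    rcases hI.disjoint_of_join with h | h <;>
      rw [Finset.disjoint_iff_inter_eq_empty.1 h] <;> grind

/-- `T.SaturatedBy I`: inside `T`, the set `I` is the chosen maximum independent set. -/
def SaturatedBy (T : Cotree V) (I : Finset V) : Prop := I ∩ T.support = T.maxIndep

theorem SaturatedBy.maxIndep_subset (h : T.SaturatedBy I) : T.maxIndep ⊆ I :=
  h ▸ Finset.inter_subset_left

theorem saturatedBy_leaf : (leaf x).SaturatedBy I ↔ x ∈ I := by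
  simp [SaturatedBy, support, maxIndep, Finset.inter_eq_right]

theorem SaturatedBy.of_isSubtree (hT : T.Valid) (hI : T.SaturatedBy I) (h : S.IsSubtree T)
    (hx : x ∈ I) (hxS : x ∈ S.support) : S.SaturatedBy I := by
  induction h with
  | refl => exact hI
  | union_left h ih | union_right h ih | join_left h ih | join_right h ih =>
    refine ih (by grind [Valid]) ?_
    have hd := Finset.disjoint_left.1 (disjoint_support_iff.2 hT.2.2)
    have hxS := h.support_subset hxS
    simp only [SaturatedBy, support, maxIndep, Finset.ext_iff, Finset.mem_inter] at hI ⊢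
    grind [Cotree.maxIndep_subset]

/-- The set obtained from `I` by replacing its part inside `S` by the chosen maximum independent
set of `S`. -/
def saturate (S : Cotree V) (I : Finset V) : Finset V := I \ S.support ∪ S.maxIndep

theorem saturatedBy_saturate (S : Cotree V) (I : Finset V) : S.SaturatedBy (S.saturate I) := by
  have := S.maxIndep_subset
  grind [SaturatedBy, saturate]

theorem saturate_eq_iff : S.saturate I = I ↔ S.SaturatedBy I := by
  have := S.maxIndep_subset
  constructor <;> intro h <;> simp only [SaturatedBy, saturate, Finset.ext_iff] at h ⊢ <;> grind

theorem Indep.card_le_card_saturate (hS : S.Valid) (hI : S.Indep I) :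
    I.card ≤ (S.saturate I).card := by
  rw [saturate, Finset.card_union_of_disjoint (Finset.sdiff_disjoint.mono_right S.maxIndep_subset),
    ← Finset.card_sdiff_add_card_inter I S.support]
  exact Nat.add_le_add_left (hI.card_inter_support_le hS) _

theorem Indep.saturate (hT : T.Valid) (hI : T.Indep I) (hS : S.IsSubtree T) (hx : x ∈ I)
    (hxS : x ∈ S.support) : T.Indep (S.saturate I) := by
  have hM := indep_maxIndep (hS.valid hT)
  have hMS := S.maxIndep_subset
  have hmod : ∀ y ∈ S.support, ∀ z ∈ I, z ∉ S.support → ¬ T.Adj y z :=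
    fun y hy z hz hzS hyz => hI x hx z hz (hS.adj_of_adj_of_notMem hT hy hxS hzS hyz)
  intro y hy z hz hyz
  have hzy := hyz.symm
  rcases Finset.mem_union.1 hy with hy | hy <;> rcases Finset.mem_union.1 hz with hz | hz
  · exact hI y (by grind) z (by grind) hyz
  · exact hmod z (hMS hz) y (by grind) (by grind) hyz.symm
  · exact hmod y (hMS hy) z (by grind) (by grind) hyz
  · exact hM y hy z hz (hS.adj_of_mem hT (hMS hy) (hMS hz) hyz)

theorem SaturatedBy.of_indep_saturate (hT : T.Valid) (hI : T.SaturatedBy I) (hS : S.IsSubtree T)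
    (h : T.Indep (S.saturate I)) : S.SaturatedBy I := by
  by_contra hn
  have hd : ∀ x ∈ I, x ∉ S.support := fun x hx hxS => hn (hI.of_isSubtree hT hS hx hxS)
  have hST := S.maxIndep_subset.trans hS.support_subset
  have hunion : S.saturate I ∩ T.support = T.maxIndep ∪ S.maxIndep := by
    rw [← hI]
    grind [Cotree.saturate]
  have hdisj : Disjoint T.maxIndep S.maxIndep :=
    Finset.disjoint_left.2 fun x hx hxS => hd x (hI.maxIndep_subset hx) (S.maxIndep_subset hxS)
  have hle := h.card_inter_support_le hT
  rw [hunion, Finset.card_union_of_disjoint hdisj] at hle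
  have := S.maxIndep_nonempty.card_pos
  omega

open Classical in
/-- The vertices of the subtrees of `T` in which `I` is saturated. -/
noncomputable def saturatedRegion (T : Cotree V) (I : Finset V) : Finset V :=
  {x ∈ T.support | ∃ S : Cotree V, S.IsSubtree T ∧ S.SaturatedBy I ∧ x ∈ S.support}

theorem mem_saturatedRegion :
    x ∈ T.saturatedRegion I ↔ ∃ S : Cotree V, S.IsSubtree T ∧ S.SaturatedBy I ∧ x ∈ S.support := by
  simp only [saturatedRegion, Finset.mem_filter, and_iff_right_iff_imp]
  rintro ⟨S, hS, -, hx⟩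
  exact hS.support_subset hx

theorem SaturatedBy.support_subset_saturatedRegion (hS : S.SaturatedBy I) (h : S.IsSubtree T) :
    S.support ⊆ T.saturatedRegion I :=
  fun _ hx => mem_saturatedRegion.2 ⟨S, h, hS, hx⟩

theorem mem_saturatedRegion_of_mem (hx : x ∈ I) (hxT : x ∈ T.support) : x ∈ T.saturatedRegion I :=
  (saturatedBy_leaf.2 hx).support_subset_saturatedRegion (isSubtree_leaf hxT)
    (Finset.mem_singleton_self x)

theorem saturatedRegion_subset_support (T : Cotree V) (I : Finset V) :
    T.saturatedRegion I ⊆ T.support := by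
  classical exact Finset.filter_subset _ _

theorem IsCotreeFor.mem_support {G : SimpleGraph V} (h : T.IsCotreeFor G) (x : V) :
    x ∈ T.support := by
  rw [← mem_verts, h.2.1]
  exact Set.mem_univ x

theorem IsCotreeFor.subset_saturatedRegion {G : SimpleGraph V} (h : T.IsCotreeFor G)
    (I : Finset V) : I ⊆ T.saturatedRegion I :=
  fun x hx => mem_saturatedRegion_of_mem hx (h.mem_support x)

theorem saturatedRegion_subset_saturate (hT : T.Valid) (hS : S.IsSubtree T)
    (h : T.Indep (S.saturate I)) : T.saturatedRegion I ⊆ T.saturatedRegion (S.saturate I) := by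
  intro x hx
  obtain ⟨A, hA, hAI, hxA⟩ := mem_saturatedRegion.1 hx
  rcases hA.laminar hT hS with hAS | hSA | hd
  · exact (saturatedBy_saturate S I).support_subset_saturatedRegion hS (hAS.support_subset hxA)
  · rw [saturate_eq_iff.2 (hAI.of_indep_saturate (hA.valid hT) hSA (h.of_isSubtree hA))]
    exact hx
  · have hAI' : A.SaturatedBy (S.saturate I) := by
      have := Finset.disjoint_left.1 hd
      have := S.maxIndep_subset
      grind [saturate, SaturatedBy]
    exact hAI'.support_subset_saturatedRegion hA hxA

theorem disjoint_saturatedRegion_saturate_sdiff (hT : T.Valid) (hS : S.IsSubtree T)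
    (h : T.Indep (S.saturate I)) : Disjoint (T.saturatedRegion I) (S.saturate I \ I) := by
  refine Finset.disjoint_left.2 fun x hx hxd => ?_
  obtain ⟨A, hA, hAI, hxA⟩ := mem_saturatedRegion.1 hx
  obtain ⟨hxS, hxI⟩ := Finset.mem_sdiff.1 hxd
  have hxM : x ∈ S.maxIndep := by grind [saturate]
  refine hxI ?_
  rcases hA.laminar hT hS with hAS | hSA | hd
  · have hAS' := (saturatedBy_saturate S I).of_isSubtree (hS.valid hT) hAS hxS hxA
    exact hAI.maxIndep_subset (hAS' ▸ Finset.mem_inter_of_mem hxS hxA)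
  · exact (hAI.of_indep_saturate (hA.valid hT) hSA (h.of_isSubtree hA)).maxIndep_subset hxM
  · exact absurd (S.maxIndep_subset hxM) (Finset.disjoint_left.1 hd hxA)

theorem card_saturatedRegion_add_card_sdiff_le (hT : T.Valid) (hS : S.IsSubtree T)
    (h : T.Indep (S.saturate I)) :
    (T.saturatedRegion I).card + (S.saturate I \ I).card ≤
      (T.saturatedRegion (S.saturate I)).card := by
  rw [← Finset.card_union_of_disjoint (disjoint_saturatedRegion_saturate_sdiff hT hS h)]
  refine Finset.card_le_card (Finset.union_subset (saturatedRegion_subset_saturate hT hS h) ?_)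
  intro x hx
  have hxS : x ∈ S.support := S.maxIndep_subset (by grind [saturate])
  exact mem_saturatedRegion_of_mem (Finset.mem_sdiff.1 hx).1 (hS.support_subset hxS)

/-- `M` cannot be improved: every subtree that could be saturated without leaving the independent
sets, and while keeping `k` tokens outside of it, is already saturated. -/
def Stable (T : Cotree V) (k : ℤ) (M : Finset V) : Prop :=
  ∀ S : Cotree V, S.IsSubtree T → k ≤ (M \ S.support).card → T.Indep (S.saturate M) →
    S.SaturatedBy M

theorem Indep.card_le_card_sdiff (hT : T.Valid) (hL : T.Indep L)
    (h : ∀ x ∈ L, ∃ S : Cotree V,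
      S.IsSubtree T ∧ S.SaturatedBy M ∧ x ∈ S.support ∧ Disjoint S.support D) :
    L.card ≤ (M \ D).card := by
  have : Nonempty (Cotree V) := ⟨T⟩
  choose! S hS hSM hxS hSD using h
  induction L using Finset.strongInduction generalizing D with
  | H L ih =>
    rcases L.eq_empty_or_nonempty with rfl | hne
    · exact Nat.zero_le _
    obtain ⟨x, hx, hmax⟩ := L.exists_max_image (fun y => (S y).support.card) hne
    have hout : (L \ (S x).support).card ≤ (M \ (D ∪ (S x).support)).card := by
      refine ih _ (by grind) (hL.mono Finset.sdiff_subset) (by grind) (by grind) (by grind) ?_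
      intro y hy
      obtain ⟨hyL, hyx⟩ := Finset.mem_sdiff.1 hy
      refine Finset.disjoint_union_right.2 ⟨hSD y hyL, ?_⟩
      rcases (hS y hyL).laminar hT (hS x hx) with hyS | hSy | hd
      · exact absurd (hyS.support_subset (hxS y hyL)) hyx
      · have heq := Finset.eq_of_subset_of_card_le hSy.support_subset (hmax y hyL)
        exact absurd (heq ▸ hxS y hyL) hyx
      · exact hd
    have hin : (L ∩ (S x).support).card ≤ (M ∩ (S x).support).card := by
      rw [hSM x hx]
      exact (hL.of_isSubtree (hS x hx)).card_inter_support_le ((hS x hx).valid hT)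
    have hxD := Finset.disjoint_left.1 (hSD x hx)
    calc L.card = (L \ (S x).support).card + (L ∩ (S x).support).card :=
          (Finset.card_sdiff_add_card_inter L _).symm
      _ ≤ (M \ (D ∪ (S x).support)).card + (M ∩ (S x).support).card := add_le_add hout hin
      _ = (M \ (D ∪ (S x).support) ∪ M ∩ (S x).support).card :=
          (Finset.card_union_of_disjoint (Finset.disjoint_left.2 (by grind))).symm
      _ ≤ (M \ D).card := Finset.card_le_card (by grind)

theorem Indep.card_sdiff_le_of_subset_saturatedRegion (hT : T.Valid) (hL : T.Indep L)
    (hLM : L ⊆ T.saturatedRegion M) (hS : S.IsSubtree T) (hSM : ¬ S.support ⊆ T.saturatedRegion M) :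
    (L \ S.support).card ≤ (M \ S.support).card := by
  refine (hL.mono Finset.sdiff_subset).card_le_card_sdiff hT fun y hy => ?_
  obtain ⟨hyL, hyS⟩ := Finset.mem_sdiff.1 hy
  obtain ⟨A, hA, hAM, hyA⟩ := mem_saturatedRegion.1 (hLM hyL)
  refine ⟨A, hA, hAM, hyA, ?_⟩
  rcases hA.laminar hT hS with hAS | hSA | hd
  · exact absurd (hAS.support_subset hyA) hyS
  · exact absurd (hSA.support_subset.trans (hAM.support_subset_saturatedRegion hA)) hSM
  · exact hd

theorem Stable.exists_adj (hT : T.Valid) (hM : T.Indep M) (hMk : T.Stable k M) (hkM : k ≤ M.card)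
    (hx : x ∈ T.support) (hxM : x ∉ M) : ∃ y ∈ M, T.Adj x y := by
  by_contra! hxy
  refine hxM (saturatedBy_leaf.1 (hMk _ (isSubtree_leaf hx) ?_ ?_))
  · rwa [support, Finset.sdiff_singleton_eq_erase, Finset.erase_eq_of_notMem hxM]
  · grind [saturate, support, maxIndep, Indep, Adj.symm, not_adj_self]

theorem Stable.mem_saturatedRegion_of_indep_insert (hT : T.Valid) (hM : T.Indep M)
    (hMk : T.Stable k M) (hkM : k ≤ M.card) (hkL : k ≤ L.card) (hLM : L ⊆ T.saturatedRegion M)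
    (hL : T.Indep (insert x L)) (hx : x ∈ T.support) : x ∈ T.saturatedRegion M := by
  by_contra hn
  obtain ⟨y, hy, hxy⟩ :=
    hMk.exists_adj hT hM hkM hx fun hxM => hn (mem_saturatedRegion_of_mem hxM hx)
  obtain ⟨A, S, hAS, hS, hxA, hyS, hadj⟩ := hxy.exists_isSubtree hT
  have hSM : ¬ S.support ⊆ T.saturatedRegion M := fun h => hn (h (hAS.support_subset hxA))
  have hcard : (M \ S.support).card < k := by
    by_contra! hk
    exact hSM ((hMk S hS hk (hM.saturate hT hS hy (by grind))).support_subset_saturatedRegion hS)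
  obtain ⟨z, hzL, hzS⟩ : ∃ z ∈ L, z ∈ S.support := by
    by_contra! hLS
    have hle := (hL.mono (Finset.subset_insert x L)).card_sdiff_le_of_subset_saturatedRegion
      hT hLM hS hSM
    rw [Finset.sdiff_eq_self_of_disjoint (Finset.disjoint_left.2 hLS)] at hle
    omega
  have hzA : z ∈ A.support := by
    by_contra hzA
    exact hL x (Finset.mem_insert_self x L) z (Finset.mem_insert_of_mem hzL)
      (hadj x hxA z (Finset.mem_sdiff.2 ⟨hzS, hzA⟩))
  obtain ⟨B, hB, hBM, hzB⟩ := mem_saturatedRegion.1 (hLM hzL)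
  rcases hB.laminar hT (hAS.trans hS) with hBA | hAB | hd
  · obtain ⟨m, hm⟩ := B.maxIndep_nonempty
    exact hM m (hBM.maxIndep_subset hm) y hy
      (hadj m (hBA.support_subset (B.maxIndep_subset hm)) y hyS)
  · exact hn (hBM.support_subset_saturatedRegion hB (hAB.support_subset hxA))
  · exact Finset.disjoint_left.1 hd hzB hzA

theorem Indep.card_le_of_subset_saturatedRegion (hT : T.Valid) (hL : T.Indep L)
    (h : L ⊆ T.saturatedRegion M) : L.card ≤ M.card := by
  refine (hL.card_le_card_sdiff (D := ∅) hT fun x hx => ?_).trans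
    (Finset.card_le_card Finset.sdiff_subset)
  obtain ⟨S, hS, hSM, hxS⟩ := mem_saturatedRegion.1 (h hx)
  exact ⟨S, hS, hSM, hxS, Finset.disjoint_empty_right _⟩

theorem eq_of_subset_saturatedRegion (hT : T.Valid) (hM : T.Indep M) (hN : T.Indep N)
    (hMN : M ⊆ T.saturatedRegion N) (hNM : N ⊆ T.saturatedRegion M) : M = N := by
  refine Finset.eq_of_subset_of_card_le (fun x hxM => ?_)
    (hN.card_le_of_subset_saturatedRegion hT hNM)
  by_contra hxN
  obtain ⟨A, hA, hAN, hxA⟩ := mem_saturatedRegion.1 (hMN hxM)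
  have hle : N.card ≤ (M \ {x}).card := by
    refine hN.card_le_card_sdiff hT fun y hy => ?_
    obtain ⟨B, hB, hBM, hyB⟩ := mem_saturatedRegion.1 (hNM hy)
    refine ⟨B, hB, hBM, hyB, Finset.disjoint_singleton_right.2 fun hxB => hxN ?_⟩
    rcases hB.laminar hT hA with hBA | hAB | hd
    · have hBN := hAN.of_isSubtree (hA.valid hT) hBA hy hyB
      exact hBN.maxIndep_subset (hBM ▸ Finset.mem_inter_of_mem hxM hxB)
    · have hAM := hBM.of_isSubtree (hB.valid hT) hAB hxM hxA
      exact hAN.maxIndep_subset (hAM ▸ Finset.mem_inter_of_mem hxM hxA)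
    · exact absurd hxA (Finset.disjoint_left.1 hd hxB)
  have hlt : (M \ {x}).card < M.card :=
    Finset.card_lt_card (Finset.sdiff_ssubset (Finset.singleton_subset_iff.2 hxM)
      (Finset.singleton_nonempty x))
  have hge := hM.card_le_of_subset_saturatedRegion hT hMN
  omega

end Cotree

section Reconfiguration

open SimpleGraph

variable {V : Type*} {G : SimpleGraph V} {k : ℤ}

/-- The independent sets of `G` of size exactly `k`, the vertices of `TJ_k(G)`. -/
abbrev IndepSetEq (G : SimpleGraph V) (k : ℤ) : Type _ :=
  {I : Finset V // G.IsIndepSet (I : Set V) ∧ (I.card : ℤ) = k}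

/-- The independent sets of `G` of size at least `k`, the vertices of `tokenAddRemGraph G k`. -/
abbrev IndepSetGE (G : SimpleGraph V) (k : ℤ) : Type _ :=
  {I : Finset V // G.IsIndepSet (I : Set V) ∧ k ≤ (I.card : ℤ)}

/-- The token addition and removal graph: two independent sets of size at least `k` are adjacent if
one of them arises from the other by adding a single vertex. -/
def tokenAddRemGraph (G : SimpleGraph V) (k : ℤ) : SimpleGraph (IndepSetGE G k) :=
  (hasse (Finset V)).comap Subtype.val

theorem tokenAddRemGraph_adj {I J : IndepSetGE G k} :
    (tokenAddRemGraph G k).Adj I J ↔ I.1 ⋖ J.1 ∨ J.1 ⋖ I.1 :=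
  Iff.rfl

variable [DecidableEq V] {T : Cotree V}

theorem exists_tokenAddRemGraph_walk_of_subset {I J : IndepSetGE G k} (h : I.1 ⊆ J.1) :
    ∃ p : (tokenAddRemGraph G k).Walk I J, p.length = (J.1 \ I.1).card := by
  induction hn : (J.1 \ I.1).card generalizing I with
  | zero =>
    obtain rfl : I = J := Subtype.ext (h.antisymm (Finset.sdiff_eq_empty_iff_subset.1
      (Finset.card_eq_zero.1 hn)))
    exact ⟨.nil, rfl⟩
  | succ n ih =>
    obtain ⟨x, hx⟩ := Finset.card_pos.1 (n.succ_pos.trans_eq hn.symm)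
    obtain ⟨hxJ, hxI⟩ := Finset.mem_sdiff.1 hx
    have hIJ : insert x I.1 ⊆ J.1 := Finset.insert_subset hxJ h
    have hcov := Finset.covBy_insert hxI
    have hcard : (J.1 \ insert x I.1).card = n := by
      rw [Finset.sdiff_insert, Finset.card_erase_of_mem hx, hn, Nat.add_sub_cancel]
    obtain ⟨p, hp⟩ := ih (I := ⟨insert x I.1, J.2.1.mono (Finset.coe_subset.2 hIJ),
      I.2.2.trans (Nat.cast_le.2 (Finset.card_le_card hcov.le))⟩) hIJ hcard
    exact ⟨.cons (tokenAddRemGraph_adj.2 (.inl hcov)) p, by rw [Walk.length_cons, hp]⟩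

theorem exists_tokenAddRemGraph_walk_of_le_card_inter {I J : IndepSetGE G k}
    (h : k ≤ (I.1 ∩ J.1).card) : ∃ p : (tokenAddRemGraph G k).Walk I J,
      p.length = (I.1 \ J.1).card + (J.1 \ I.1).card := by
  let K : IndepSetGE G k :=
    ⟨I.1 ∩ J.1, I.2.1.mono (Finset.coe_subset.2 Finset.inter_subset_left), h⟩
  obtain ⟨p, hp⟩ := exists_tokenAddRemGraph_walk_of_subset (I := K) (J := I)
    Finset.inter_subset_left
  obtain ⟨q, hq⟩ := exists_tokenAddRemGraph_walk_of_subset (I := K) (J := J)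
    Finset.inter_subset_right
  refine ⟨p.reverse.append q, ?_⟩
  rw [Walk.length_append, Walk.length_reverse, hp, hq, Finset.sdiff_inter_self_left,
    Finset.sdiff_inter_self_right]

theorem exists_tokenAddRemGraph_walk_to_stable (hT : T.IsCotreeFor G) (I : IndepSetGE G k) :
    ∃ M, T.Stable k M.1 ∧ ∃ p : (tokenAddRemGraph G k).Walk I M,
      p.length + 2 * (T.saturatedRegion I.1).card ≤ 2 * (T.saturatedRegion M.1).card := by
  induction hn : T.support.card - (T.saturatedRegion I.1).card using Nat.strong_induction_on
    generalizing I with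
  | h n ih =>
    by_cases hI : T.Stable k I.1
    · exact ⟨I, hI, .nil, by rw [Walk.length_nil, zero_add]⟩
    simp only [Cotree.Stable, not_forall] at hI
    obtain ⟨S, hS, hk, hSI, hsat⟩ := hI
    have hcard := ((hT.indep_iff.2 I.2.1).of_isSubtree hS).card_le_card_saturate (hS.valid hT.1)
    have hregion := Cotree.card_saturatedRegion_add_card_sdiff_le hT.1 hS hSI
    have hsupport := Finset.card_le_card (T.saturatedRegion_subset_support (S.saturate I.1))
    have hdiff := Finset.card_sdiff_le_card_sdiff_iff.2 hcard
    have hpos : 0 < (S.saturate I.1 \ I.1).card := by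
      refine Finset.card_pos.2 (Finset.nonempty_iff_ne_empty.2 fun h => hsat ?_)
      exact Cotree.saturate_eq_iff.1 (Finset.eq_of_subset_of_card_le
        (Finset.sdiff_eq_empty_iff_subset.1 h) hcard)
    have hinter : I.1 \ S.support ⊆ I.1 ∩ S.saturate I.1 := by grind [Cotree.saturate]
    obtain ⟨J, hJ⟩ : ∃ J : IndepSetGE G k, J.1 = S.saturate I.1 :=
      ⟨⟨_, hT.indep_iff.1 hSI, I.2.2.trans (Nat.cast_le.2 hcard)⟩, rfl⟩
    rw [← hJ] at hregion hsupport hdiff hpos hinter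
    obtain ⟨p, hp⟩ := exists_tokenAddRemGraph_walk_of_le_card_inter
      (hk.trans (Nat.cast_le.2 (Finset.card_le_card hinter)))
    obtain ⟨M, hM, q, hq⟩ := ih _ (by omega) J rfl
    exact ⟨M, hM, p.append q, by rw [Walk.length_append]; omega⟩

theorem Cotree.Stable.subset_saturatedRegion_of_walk (hT : T.IsCotreeFor G)
    {M L L' : IndepSetGE G k} (hM : T.Stable k M.1) (p : (tokenAddRemGraph G k).Walk L L')
    (hL : L.1 ⊆ T.saturatedRegion M.1) : L'.1 ⊆ T.saturatedRegion M.1 := by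
  induction p with
  | nil => exact hL
  | @cons L K _ h _ ih =>
    refine ih ?_
    rcases tokenAddRemGraph_adj.1 h with h | h
    · obtain ⟨x, -, hx⟩ := Finset.covBy_iff_exists_insert.1 h
      have hxM := hM.mem_saturatedRegion_of_indep_insert hT.1 (hT.indep_iff.2 M.2.1) M.2.2 L.2.2 hL
        (hx ▸ hT.indep_iff.2 K.2.1) (hT.mem_support x)
      exact hx ▸ Finset.insert_subset hxM hL
    · exact h.le.trans hL

theorem Cotree.Stable.eq_of_reachable (hT : T.IsCotreeFor G) {M N : IndepSetGE G k}
    (hM : T.Stable k M.1) (hN : T.Stable k N.1) (h : (tokenAddRemGraph G k).Reachable M N) :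
    M = N := by
  obtain ⟨p⟩ := h
  exact Subtype.ext (Cotree.eq_of_subset_saturatedRegion hT.1 (hT.indep_iff.2 M.2.1)
    (hT.indep_iff.2 N.2.1)
    (hN.subset_saturatedRegion_of_walk hT p.reverse (hT.subset_saturatedRegion N.1))
    (hM.subset_saturatedRegion_of_walk hT p (hT.subset_saturatedRegion M.1)))

omit [DecidableEq V] in
theorem exists_tokenAddRemGraph_walk_of_reachable [Fintype V] (hT : T.IsCotreeFor G)
    {I J : IndepSetGE G k} (h : (tokenAddRemGraph G k).Reachable I J) :
    ∃ p : (tokenAddRemGraph G k).Walk I J,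
      p.length + 2 * I.1.card + 2 * J.1.card ≤ 4 * Fintype.card V := by
  classical
  obtain ⟨M, hM, p, hp⟩ := exists_tokenAddRemGraph_walk_to_stable hT I
  obtain ⟨N, hN, q, hq⟩ := exists_tokenAddRemGraph_walk_to_stable hT J
  obtain rfl := hM.eq_of_reachable hT hN (p.reachable.symm.trans (h.trans q.reachable))
  refine ⟨p.append q.reverse, ?_⟩
  have hI := Finset.card_le_card (hT.subset_saturatedRegion I.1)
  have hJ := Finset.card_le_card (hT.subset_saturatedRegion J.1)
  have hn := Finset.card_le_univ (T.saturatedRegion M.1)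
  rw [Walk.length_append, Walk.length_reverse]
  omega

theorem tokenJumpingGraph_adj_iff {I J : IndepSetEq G k} :
    (tokenJumpingGraph G k).Adj I J ↔ I ≠ J ∧ k - 1 ≤ (I.1 ∩ J.1).card := by
  have := I.2.2
  have := J.2.2
  have hIJ := Finset.card_sdiff_add_card_inter I.1 J.1
  have hJI := Finset.card_sdiff_add_card_inter J.1 I.1
  rw [Finset.inter_comm] at hJI
  refine and_congr_right fun hne => ⟨?_, fun h => ?_⟩
  · rintro ⟨u, hu, v, -, h⟩
    have hle := Finset.card_le_card
      (Finset.subset_inter Finset.sdiff_subset (h ▸ Finset.sdiff_subset) : I.1 \ {u} ⊆ I.1 ∩ J.1)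
    rw [Finset.sdiff_singleton_eq_erase, Finset.card_erase_of_mem hu] at hle
    omega
  · have hpos : 0 < (I.1 \ J.1).card := by
      refine Finset.card_pos.2 (Finset.nonempty_iff_ne_empty.2 fun h => hne (Subtype.ext ?_))
      exact Finset.eq_of_subset_of_card_le (Finset.sdiff_eq_empty_iff_subset.1 h) (by omega)
    obtain ⟨u, hu⟩ := Finset.card_eq_one.1 (show (I.1 \ J.1).card = 1 by omega)
    obtain ⟨v, hv⟩ := Finset.card_eq_one.1 (show (J.1 \ I.1).card = 1 by omega)
    refine ⟨u, (Finset.mem_sdiff.1 (hu ▸ Finset.mem_singleton_self u)).1,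
      v, (Finset.mem_sdiff.1 (hv ▸ Finset.mem_singleton_self v)).1, ?_⟩
    rw [← hu, ← hv, Finset.sdiff_sdiff_self_left, Finset.sdiff_sdiff_self_left]
    exact Finset.inter_comm _ _

/-- An independent set of size `k` as a vertex of `tokenAddRemGraph G (k - 1)`; the threshold
leaves room for removing the token that jumps. -/
def IndepSetEq.toGE (I : IndepSetEq G k) : IndepSetGE G (k - 1) :=
  ⟨I.1, I.2.1, by linarith [I.2.2]⟩

theorem reachable_toGE {I J : IndepSetEq G k} (h : (tokenJumpingGraph G k).Reachable I J) :
    (tokenAddRemGraph G (k - 1)).Reachable I.toGE J.toGE := by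
  obtain ⟨p⟩ := h
  induction p with
  | nil => rfl
  | cons h _ ih =>
    obtain ⟨q, -⟩ := exists_tokenAddRemGraph_walk_of_le_card_inter (I := IndepSetEq.toGE _)
      (J := IndepSetEq.toGE _) (tokenJumpingGraph_adj_iff.1 h).2
    exact q.reachable.trans ih

theorem card_bounds_of_covBy_of_not_comparable {A S S' : Finset V} (h : S ⋖ S' ∨ S' ⋖ S)
    (hA : A ⊆ S' ∨ S' ⊆ A) (hAS : ¬ (A ⊆ S ∨ S ⊆ A)) (hcard : A.card ≤ S'.card + 1) :
    A.card ≤ S.card ∧ A.card ≤ (A ∩ S).card + 1 ∧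
      |(S.card : ℤ) - A.card| + 1 = |(S'.card : ℤ) - A.card| := by
  obtain ⟨hAS, hSA⟩ := not_or.1 hAS
  rcases h with h | h
  · have hAS' : A ⊆ S' := hA.resolve_right fun hS' => hSA (h.le.trans hS')
    have hlt : A.card < S'.card :=
      Finset.card_lt_card (hAS'.ssubset_of_ne fun hne => hSA (hne ▸ h.le))
    obtain ⟨x, hx, rfl⟩ := Finset.covBy_iff_exists_insert.1 h
    have hle : A.card ≤ (insert x (A ∩ S)).card := Finset.card_le_card (by grind)
    have := Finset.card_insert_le x (A ∩ S)
    rw [Finset.card_insert_of_notMem hx] at hlt hcard ⊢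
    grind
  · have hS'A : S' ⊆ A := hA.resolve_left fun hA => hAS (hA.trans h.le)
    have hlt : S'.card < A.card :=
      Finset.card_lt_card (hS'A.ssubset_of_ne fun hne => hAS (hne ▸ h.le))
    have hle := Finset.card_le_card (Finset.subset_inter hS'A h.le)
    obtain ⟨x, hx, rfl⟩ := Finset.covBy_iff_exists_insert.1 h
    rw [Finset.card_insert_of_notMem hx]
    grind

/-- Amortization: two token additions or removals pay for one jump, with the distance between `k`
and the size of the set as the potential. -/
theorem exists_tokenJumpingGraph_walk_of_adj {S S' : IndepSetGE G (k - 1)} {A : IndepSetEq G k}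
    (h : (tokenAddRemGraph G (k - 1)).Adj S S') (hA : A.1 ⊆ S'.1 ∨ S'.1 ⊆ A.1) :
    ∃ B, (B.1 ⊆ S.1 ∨ S.1 ⊆ B.1) ∧ ∃ q : (tokenJumpingGraph G k).Walk B A,
      2 * q.length + |(S.1.card : ℤ) - k| ≤ |(S'.1.card : ℤ) - k| + 1 := by
  have hAk := A.2.2
  rw [tokenAddRemGraph_adj] at h
  by_cases hAS : A.1 ⊆ S.1 ∨ S.1 ⊆ A.1
  · refine ⟨A, hAS, .nil, ?_⟩
    have := h.imp CovBy.card_finset CovBy.card_finset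
    simp only [Nat.covBy_iff_add_one_eq] at this
    rw [Walk.length_nil]
    grind
  obtain ⟨hcard, hinter, hcost⟩ := card_bounds_of_covBy_of_not_comparable h hA hAS
    (by have := S'.2.2; omega)
  obtain ⟨B, hAB, hBS, hB⟩ := Finset.exists_subsuperset_card_eq
    (Finset.inter_subset_right : A.1 ∩ S.1 ⊆ S.1) (Finset.card_le_card Finset.inter_subset_left)
    hcard
  have hadj : (tokenJumpingGraph G k).Adj
      ⟨B, S.2.1.mono (Finset.coe_subset.2 hBS), hB ▸ hAk⟩ A := by
    refine tokenJumpingGraph_adj_iff.2 ⟨fun h => hAS (.inl (h ▸ hBS)), ?_⟩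
    have hle := Finset.card_le_card (Finset.subset_inter hAB Finset.inter_subset_left)
    change k - 1 ≤ ((B ∩ A.1).card : ℤ)
    omega
  refine ⟨_, .inl hBS, hadj.toWalk, ?_⟩
  rw [hAk] at hcost
  rw [Walk.length_cons, Walk.length_nil]
  push_cast
  linarith

theorem exists_tokenJumpingGraph_walk_of_walk {S S' : IndepSetGE G (k - 1)} {J : IndepSetEq G k}
    (p : (tokenAddRemGraph G (k - 1)).Walk S S') (hJ : J.1 = S'.1) :
    ∃ A, (A.1 ⊆ S.1 ∨ S.1 ⊆ A.1) ∧ ∃ q : (tokenJumpingGraph G k).Walk A J,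
      2 * q.length + |(S.1.card : ℤ) - k| ≤ p.length := by
  induction p with
  | nil => exact ⟨J, .inl hJ.le, .nil, by simp [← hJ, J.2.2]⟩
  | cons h p ih =>
    obtain ⟨A, hA, q, hq⟩ := ih hJ
    obtain ⟨B, hB, q', hq'⟩ := exists_tokenJumpingGraph_walk_of_adj h hA
    refine ⟨B, hB, q'.append q, ?_⟩
    rw [Walk.length_append, Walk.length_cons]
    push_cast
    linarith

theorem exists_tokenJumpingGraph_walk_of_reachable [Fintype V] (hG : IsCograph G)
    {I J : IndepSetEq G k} (h : (tokenJumpingGraph G k).Reachable I J) :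
    ∃ q : (tokenJumpingGraph G k).Walk I J, (q.length : ℤ) ≤ 2 * (Fintype.card V - k) := by
  obtain ⟨T, hT⟩ := hG
  obtain ⟨p, hp⟩ := exists_tokenAddRemGraph_walk_of_reachable hT (reachable_toGE h)
  obtain ⟨A, hA, q, hq⟩ := exists_tokenJumpingGraph_walk_of_walk p (J := J) rfl
  have hI : (I.toGE.1.card : ℤ) = k := I.2.2
  have hJ : (J.toGE.1.card : ℤ) = k := J.2.2
  obtain rfl : A = I := by
    refine Subtype.ext ?_
    have hcard : A.1.card = I.1.card := Nat.cast_injective (A.2.2.trans I.2.2.symm)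
    rcases hA with hA | hA
    · exact Finset.eq_of_subset_of_card_le hA hcard.ge
    · exact (Finset.eq_of_subset_of_card_le hA hcard.le).symm
  refine ⟨q, ?_⟩
  rw [hI, sub_self, abs_zero] at hq
  omega

end Reconfiguration

theorem edist_toSimpleGraph_le_of_walk {V : Type*} {G : SimpleGraph V} (C : G.ConnectedComponent)
    {u v : V} (hu : u ∈ C) (hv : v ∈ C) (p : G.Walk u v) :
    C.toSimpleGraph.edist ⟨u, hu⟩ ⟨v, hv⟩ ≤ p.length := by
  classical
  have hp : ∀ w ∈ p.support, w ∈ C.supp := fun w hw =>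
    (SimpleGraph.ConnectedComponent.sound (p.takeUntil w hw).reachable).symm.trans hu
  have := (p.induce C.supp hp).edist_le
  rwa [← SimpleGraph.Walk.length_map, SimpleGraph.Walk.map_induce] at this

theorem mainTheorem8_general {V : Type*} [Fintype V] [DecidableEq V] (G : SimpleGraph V)
    (hG : IsCograph G) (k : ℤ) (C : (tokenJumpingGraph G k).ConnectedComponent) :
    C.toSimpleGraph.ediam ≠ ⊤ ∧
      (C.toSimpleGraph.diam : ℤ) ≤ 2 * ((Fintype.card V : ℤ) - k) := by
  have hk : k ≤ Fintype.card V := by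
    obtain ⟨I, -⟩ := C.nonempty_supp
    exact I.2.2.symm.le.trans (Nat.cast_le.2 (Finset.card_le_univ I.1))
  have hediam : C.toSimpleGraph.ediam ≤ (2 * ((Fintype.card V : ℤ) - k)).toNat := by
    refine SimpleGraph.ediam_le_of_edist_le fun ⟨I, hI⟩ ⟨J, hJ⟩ => ?_
    obtain ⟨q, hq⟩ :=
      exists_tokenJumpingGraph_walk_of_reachable hG (C.reachable_of_mem_supp hI hJ)
    exact (edist_toSimpleGraph_le_of_walk C hI hJ q).trans (Nat.cast_le.2 (by omega))
  refine ⟨(hediam.trans_lt (ENat.natCast_lt_top _)).ne, ?_⟩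
  have hdiam := ENat.toNat_le_of_le_natCast hediam
  exact (Nat.cast_le.2 hdiam).trans (by omega)

theorem mainTheorem8 {V : Type*} [Fintype V] [DecidableEq V] (G : SimpleGraph V)
    (hG : IsCograph G) (k : ℤ) (C : (tokenJumpingGraph G k).ConnectedComponent) :
    C.toSimpleGraph.ediam ≠ ⊤ ∧
      (C.toSimpleGraph.diam : ℤ) ≤ 2 * (Fintype.card V : ℤ) - k := by
  obtain ⟨I, -⟩ := C.nonempty_supp
  exact (mainTheorem8_general G hG k C).imp_right (by have := I.2.2; omega)
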